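/- Let $c,d\ge 1$ be integers, let $G=\langle a,b : ab^c=b^da\rangle$ be the Baumslag--Solitar group, and let $P\subseteq G$ be the submonoid generated by $a$ and $b$. For $g,h\in G$ write $g\le h$ if $g^{-1}h\in P$. For $x,y\in P$ let $x\vee y$ denote the least upper bound of $x$ and $y$ in $P$ if they have an upper bound in $P$, and put $x\vee y=\infty$ otherwise. Let $\theta:G\to\mathbb{Z}$ be the homomorphism with $\theta(a)=1$ and $\theta(b)=0$. Let $C^*(G,P)$ be the universal unital $C^*$-algebra generated by a Nica-covariant isometric representation $T:P\to C^*(G,P)$, that is, a monoid homomorphism into isometries such that $T_xT_x^*T_yT_y^*=T_{x\vee y}T_{x\vee y}^*$ if $x\vee y<\infty$ and $T_xT_x^*T_yT_y^*=0$ if $x\vee y=\infty$. Let $\alpha$ be the action of $\mathbb{R}$ on $C^*(G,P)$ with $\alpha_t(T_x)=e^{it\theta(x)}T_x$ for $x\in P$. Let $\beta\in\mathbb{R}$. A state $\psi$ of $C^*(G,P)$ is a KMS$_\beta$ state if $\psi(fg)=\psi(g\,\alpha_{i\beta}(f))$ for all $f,g\in C^*(G,P)$ that are analytic for $\alpha$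 (where $f$ is analytic if $t\mapsto\alpha_t(f)$ extends to an entire function $z\mapsto\alpha_z(f)$); when $\beta=0$ it is also required, as usual, that $\psi$ be $\alpha$-invariant. (1) A state $\psi$ of $C^*(G,P)$ is a KMS$_\beta$ state if and only if, for all $x,y\in P$, \[ \psi(T_xT_y^*)=\begin{cases} e^{-\beta\theta(x)}\,\psi(T_{y^{-1}x}) & \text{if }\theta(x)=\theta(y)\text{ and }x\vee y=x,\\ e^{-\beta\theta(x)}\,\psi(T_{x^{-1}y}^*) & \text{if }\theta(x)=\theta(y)\text{ and }x\vee y=y,\\ 0 & \text{otherwise.} \end{cases} \] (2) If $\phi$ and $\psi$ are KMS$_\beta$ states of $C^*(G,P)$ and $\phi(T_{b^t})=\psi(T_{b^t})$ for all $t\in\mathbb{N}=\{0,1,2,\dots\}$, then $\phi=\psi$. -/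

import Mathlib

open scoped ENNReal

noncomputable section

/-! ### Quasi-lattice order -/

section QuasiLattice

variable {G : Type} [Group G] (P : Submonoid G)

/-- The left-invariant relation on `G` defined by `P`: `g ≤ h` means `g⁻¹ h ∈ P`. -/
def PLe (g h : G) : Prop := g⁻¹ * h ∈ P

/-- `IsJoin P x y z` says that `z = x ∨ y`: `z` lies in `P`, is an upper bound of `x` and `y`,
and is below every upper bound of `x` and `y` that lies in `P`. -/
structure IsJoin (x y z : G) : Prop where
  mem : z ∈ P
  left_le : PLe P x z
  right_le : PLe P y z
  least : ∀ w ∈ P, PLe P x w → PLe P y w → PLe P z w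

/-- `x ∨ y = ∞`: there is no upper bound of `x` and `y` in `P`. -/
def JoinInfinite (x y : G) : Prop := ¬ ∃ w ∈ P, PLe P x w ∧ PLe P y w

/-! ### Nica-covariant representations -/

/-- An isometric representation `S` of the monoid `P` in a unital C*-algebra is Nica covariant when
`S_x S_x^* S_y S_y^*` is `S_{x ∨ y} S_{x ∨ y}^*` if `x ∨ y < ∞`, and `0` if `x ∨ y = ∞`. -/
structure IsNicaCovariant {B : Type*} [CStarAlgebra B] (S : P →* B) : Prop where
  isometry : ∀ x : P, star (S x) * S x = 1
  covariant : ∀ x y z : P, IsJoin P (x : G) y z →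
    S x * star (S x) * (S y * star (S y)) = S z * star (S z)
  covariant_infinite : ∀ x y : P, JoinInfinite P (x : G) y →
    S x * star (S x) * (S y * star (S y)) = 0

/-- A Nica-covariant isometric representation of `P` in some nonzero unital C*-algebra. -/
structure NicaRep where
  B : Type
  [cstar : CStarAlgebra B]
  [nontrivial : Nontrivial B]
  S : P →* B
  isNica : IsNicaCovariant P S

attribute [instance] NicaRep.cstar NicaRep.nontrivial

/-! ### The universal C*-algebra `C*(G, P)` -/

/-- The C*-algebra of bounded families indexed by all Nica-covariant representations of `P`, whose
component at a representation `R` lies in the C*-algebra in which `R` takes its values. -/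
abbrev NicaProduct : Type 1 := lp (fun R : NicaRep P => R.B) ∞

variable {P} in
theorem NicaRep.norm_apply (R : NicaRep P) (x : P) : ‖R.S x‖ = 1 := by
  have h := CStarRing.norm_star_mul_self (x := R.S x)
  rw [R.isNica.isometry x, norm_one] at h
  nlinarith [norm_nonneg (R.S x)]

/-- The family of all Nica-covariant representations, as a single representation. -/
def productRep : P →* NicaProduct P where
  toFun x := ⟨fun R => R.S x, memℓp_infty ⟨1, by rintro _ ⟨R, rfl⟩; exact (R.norm_apply x).le⟩⟩
  map_one' := by ext R; simp
  map_mul' x y := by ext R; simp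

/-- `C*(G, P)`, as a closed *-subalgebra: it is generated by the image of the family of all
Nica-covariant representations. Equivalently, it is the completion of the free *-algebra on the
`T_x` in the largest C*-seminorm coming from a Nica-covariant representation; see
`CStarGP.exists_unique_lift` for its universal property. -/
def cstarGP : StarSubalgebra ℂ (NicaProduct P) :=
  (StarAlgebra.adjoin ℂ (Set.range (productRep P))).topologicalClosure

/-- The universal C*-algebra `C*(G, P)`. -/
abbrev CStarGP : Type 1 := cstarGP P

instance : IsClosed (cstarGP P : Set (NicaProduct P)) :=
  StarSubalgebra.isClosed_topologicalClosure _

instance : CompleteSpace (CStarGP P) :=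
  (inferInstance : IsClosed (cstarGP P : Set (NicaProduct P))).completeSpace_coe

/-- The norm, algebra and involution of `C*(G, P)` make it a C*-algebra. -/
instance : CStarAlgebra (CStarGP P) where

/-- The universal Nica-covariant representation `T : P → C*(G, P)`. -/
def toeplitz : P →* CStarGP P :=
  (productRep P).codRestrict (cstarGP P) fun x =>
    StarSubalgebra.le_topologicalClosure _ (StarAlgebra.subset_adjoin ℂ _ ⟨x, rfl⟩)

theorem toeplitz_apply (x : P) (R : NicaRep P) : (toeplitz P x : NicaProduct P) R = R.S x := rfl

/-- `T` is itself a Nica-covariant isometric representation. -/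
theorem toeplitz_isNicaCovariant : IsNicaCovariant P (toeplitz P) where
  isometry x := by
    apply Subtype.ext; apply lp.ext; funext R
    exact R.isNica.isometry x
  covariant x y z h := by
    apply Subtype.ext; apply lp.ext; funext R
    exact R.isNica.covariant x y z h
  covariant_infinite x y h := by
    apply Subtype.ext; apply lp.ext; funext R
    exact R.isNica.covariant_infinite x y h

/-- Evaluation at a Nica-covariant representation `R`: the homomorphism `π_R` of `C*(G, P)`. -/
def evalRep (R : NicaRep P) : CStarGP P →⋆ₐ[ℂ] R.B where
  toFun a := (a : NicaProduct P) R
  map_one' := rfl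
  map_mul' _ _ := rfl
  map_zero' := rfl
  map_add' _ _ := rfl
  commutes' _ := rfl
  map_star' _ := rfl

open scoped CStarAlgebra in
/-- Two *-homomorphisms on `C*(G, P)` that agree on all `T_x` are equal. -/
theorem CStarGP.hom_ext {B : Type*} [CStarAlgebra B] {f g : CStarGP P →⋆ₐ[ℂ] B}
    (h : ∀ x, f (toeplitz P x) = g (toeplitz P x)) : f = g := by
  have hf : Continuous f := map_continuous f
  have hg : Continuous g := map_continuous g
  refine StarAlgHom.ext_topologicalClosure hf hg ?_
  refine StarAlgHom.ext_adjoin ?_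
  rintro ⟨_, hy⟩ ⟨x, rfl⟩
  exact h x

/-- The universal property of `(C*(G, P), T)`. -/
theorem CStarGP.exists_unique_lift (R : NicaRep P) :
    ∃! f : CStarGP P →⋆ₐ[ℂ] R.B, ∀ x, f (toeplitz P x) = R.S x :=
  ⟨evalRep P R, fun _ => rfl, fun _ hg => CStarGP.hom_ext P fun x => hg x⟩

/-! ### Gauge automorphisms -/

variable {P}

/-- The representation `x ↦ χ(x) S_x`, for a character `χ` of `P`. -/
def NicaRep.twist (χ : P →* Circle) (R : NicaRep P) : NicaRep P where
  B := R.B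
  S := { toFun := fun x => (χ x : ℂ) • R.S x
         map_one' := by simp
         map_mul' := fun x y => by simp [smul_smul, mul_comm] }
  isNica :=
    have key : ∀ x, ((starRingEnd ℂ) (χ x : ℂ)) * (χ x : ℂ) = 1 := fun x => by
      rw [← Circle.coe_inv_eq_conj, ← Circle.coe_mul, inv_mul_cancel, Circle.coe_one]
    have key' : ∀ x, (χ x : ℂ) * ((starRingEnd ℂ) (χ x : ℂ)) = 1 := fun x => by
      rw [mul_comm, key]
    { isometry := fun x => by
        simp [star_smul, smul_smul, key', R.isNica.isometry x]
      covariant := fun x y z h => by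
        simpa [star_smul, smul_smul, key, key'] using R.isNica.covariant x y z h
      covariant_infinite := fun x y h => by
        simpa [star_smul, smul_smul, key, key'] using R.isNica.covariant_infinite x y h }

/-- Reindexing of bounded families along `R ↦ R.twist χ`. -/
def productTwist (χ : P →* Circle) : NicaProduct P →⋆ₐ[ℂ] NicaProduct P where
  toFun f := ⟨fun R => f (R.twist χ), memℓp_infty
    ⟨‖f‖, by rintro _ ⟨R, rfl⟩; exact lp.norm_apply_le_norm (by simp) f (R.twist χ)⟩⟩
  map_one' := rfl
  map_mul' _ _ := rfl
  map_zero' := rfl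
  map_add' _ _ := rfl
  commutes' _ := rfl
  map_star' _ := rfl

theorem productTwist_productRep (χ : P →* Circle) (x : P) :
    productTwist χ (productRep P x) = (χ x : ℂ) • productRep P x := rfl

theorem productTwist_mem (χ : P →* Circle) {f : NicaProduct P} (hf : f ∈ cstarGP P) :
    productTwist χ f ∈ cstarGP P := by
  have hc : Continuous (productTwist χ) :=
    AddMonoidHomClass.continuous_of_bound (productTwist χ) 1 fun f => by
      rw [one_mul]
      exact lp.norm_le_of_forall_le (norm_nonneg f)
        fun R => lp.norm_apply_le_norm (by simp) f (R.twist χ)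
  have hle : StarAlgebra.adjoin ℂ (Set.range (productRep P)) ≤
      (cstarGP P).comap (productTwist χ) := by
    refine StarAlgebra.adjoin_le ?_
    rintro _ ⟨x, rfl⟩
    change productTwist χ (productRep P x) ∈ cstarGP P
    rw [productTwist_productRep]
    exact SMulMemClass.smul_mem _ (toeplitz P x).2
  exact StarSubalgebra.topologicalClosure_minimal hle
    ((inferInstance : IsClosed (cstarGP P : Set (NicaProduct P))).preimage hc) hf

/-- The endomorphism of `C*(G, P)` with `T_x ↦ χ(x) T_x`. -/
def gaugeHom (χ : P →* Circle) : CStarGP P →⋆ₐ[ℂ] CStarGP P where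
  toFun a := ⟨productTwist χ a, productTwist_mem χ a.2⟩
  map_one' := rfl
  map_mul' _ _ := rfl
  map_zero' := rfl
  map_add' _ _ := rfl
  commutes' _ := rfl
  map_star' _ := rfl

theorem gaugeHom_toeplitz (χ : P →* Circle) (x : P) :
    gaugeHom χ (toeplitz P x) = (χ x : ℂ) • toeplitz P x := rfl

theorem gaugeHom_comp (χ η : P →* Circle) :
    (gaugeHom χ).comp (gaugeHom η) = gaugeHom (χ * η) := by
  refine CStarGP.hom_ext P fun x => ?_
  simp [gaugeHom_toeplitz, smul_smul, mul_comm]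

theorem gaugeHom_one : gaugeHom (1 : P →* Circle) = StarAlgHom.id ℂ (CStarGP P) := by
  refine CStarGP.hom_ext P fun x => ?_
  simp [gaugeHom_toeplitz]

/-- The automorphism of `C*(G, P)` with `T_x ↦ χ(x) T_x`, for a character `χ` of `P`. -/
def gaugeAut (χ : P →* Circle) : CStarGP P ≃⋆ₐ[ℂ] CStarGP P :=
  StarAlgEquiv.ofStarAlgHom (gaugeHom χ) (gaugeHom χ⁻¹)
    (by rw [gaugeHom_comp, inv_mul_cancel, gaugeHom_one])
    (by rw [gaugeHom_comp, mul_inv_cancel, gaugeHom_one])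

end QuasiLattice

/-! ### States and the KMS condition -/

section KMS

open scoped ComplexOrder

variable {A : Type*} [CStarAlgebra A]

/-- A state of a unital C*-algebra: a positive linear functional with value `1` at the identity. -/
structure IsState (ψ : A →L[ℂ] ℂ) : Prop where
  nonneg : ∀ a : A, 0 ≤ ψ (star a * a)
  map_one : ψ 1 = 1

/-- `F` is an entire `A`-valued function extending `t ↦ α_t(a)`, that is, `F z = α_z(a)`. -/
def IsEntireExtension (α : ℝ → A ≃⋆ₐ[ℂ] A) (a : A) (F : ℂ → A) : Prop :=
  Differentiable ℂ F ∧ ∀ t : ℝ, F t = α t a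

/-- `a` is an analytic element for `α`. -/
def IsAnalyticElement (α : ℝ → A ≃⋆ₐ[ℂ] A) (a : A) : Prop :=
  ∃ F : ℂ → A, IsEntireExtension α a F

/-- The state `ψ` is a KMS state at inverse temperature `β` for the dynamics `α`:
`ψ(ab) = ψ(b α_{iβ}(a))` for all analytic elements `a` and `b`. By the usual convention, KMS
states at inverse temperature `0` (that is, traces) are required to be invariant under `α`; for
`β ≠ 0` invariance is automatic and not required. -/
structure IsKMSState (α : ℝ → A ≃⋆ₐ[ℂ] A) (β : ℝ) (ψ : A →L[ℂ] ℂ) : Prop where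
  isState : IsState ψ
  kms : ∀ (a b : A) (F : ℂ → A), IsEntireExtension α a F → IsAnalyticElement α b →
    ψ (a * b) = ψ (b * F (Complex.I * β))
  invariant : β = 0 → ∀ (t : ℝ) (a : A), ψ (α t a) = ψ a

end KMS

/-! ### Baumslag-Solitar groups -/

/-- The two generators. -/
inductive BSGen
  | a
  | b

/-- The relator `a b^c (b^d a)⁻¹`. -/
def bsRels (c d : ℕ) : Set (FreeGroup BSGen) :=
  {FreeGroup.of .a * FreeGroup.of .b ^ c * (FreeGroup.of .b ^ d * FreeGroup.of .a)⁻¹}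

/-- The Baumslag-Solitar group `BS(c, d) = ⟨a, b : a b^c = b^d a⟩`. -/
abbrev BS (c d : ℕ) : Type := PresentedGroup (bsRels c d)

variable (c d : ℕ)

/-- The submonoid `P` of `BS(c, d)` generated by `a` and `b`. -/
def bsP : Submonoid (BS c d) :=
  Submonoid.closure {PresentedGroup.of .a, PresentedGroup.of .b}

/-- The generator `b` as an element of `P`. -/
def bsB : bsP c d := ⟨PresentedGroup.of .b, Submonoid.subset_closure (by simp)⟩

/-- The height homomorphism `θ : G → ℤ` with `θ(a) = 1` and `θ(b) = 0`, written multiplicatively. -/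
def bsHeightHom : BS c d →* Multiplicative ℤ :=
  PresentedGroup.toGroup (f := fun | .a => Multiplicative.ofAdd 1 | .b => 1)
    (by rintro r rfl; simp)

/-- The height `θ(g)`, an integer. -/
def bsHeight (g : BS c d) : ℤ := (bsHeightHom c d g).toAdd

/-- The character `x ↦ z ^ θ(x)` of `P`. -/
def heightChar (z : Circle) : bsP c d →* Circle :=
  (zpowersHom Circle z).comp ((bsHeightHom c d).comp (bsP c d).subtype)

/-- The gauge action of the circle on `C*(G, P)`, with `γ_z(T_x) = z ^ θ(x) T_x`. -/
def bsGauge (z : Circle) : CStarGP (bsP c d) ≃⋆ₐ[ℂ] CStarGP (bsP c d) :=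
  gaugeAut (heightChar c d z)

/-- The dynamics `α_t = γ_{exp(it)}` on `C*(G, P)`. -/
def bsDynamics (t : ℝ) : CStarGP (bsP c d) ≃⋆ₐ[ℂ] CStarGP (bsP c d) :=
  bsGauge c d (Circle.exp t)

theorem bsGauge_toeplitz (z : Circle) (x : bsP c d) :
    bsGauge c d z (toeplitz _ x) = ((z ^ bsHeight c d x : Circle) : ℂ) • toeplitz _ x := by
  exact gaugeHom_toeplitz (heightChar c d z) x

end

/-! Every element of `P` is a power of `b` or has the form `b^k a y` with `y ∈ P`, and `a b^(cm) =
b^(dm) a`. The one fact about `G` that is not formal is that `a p = b^i a q` with `p, q ∈ P` forces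
`d ∣ i` (`dvd_of_genA_mul_eq`). An action of `G` on `ℤ × (ℕ ⊕ ℕ)` shows it: `b` shifts the integer,
`P` preserves `ℤ × inl ℕ`, and `a` maps this set into `dℤ × inl ℕ`. Common prefixes can then be
cancelled. Two elements with an upper bound therefore have a join that is one of them times a power
of `b` (`exists_isJoin`), and if their heights agree they are comparable (`isJoin_left_or_right`).

By Nica covariance each `T_x^* T_y` is `0` or some `T_u T_v^*`, so the `T_x T_y^*` span a dense
subspace. The formula of (1) takes the uniform shape `ψ(T_x T_y^*) = e^(-βθ(x)) ψ(T_y^* T_x)` for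
equal heights and `0` otherwise (`IsHeightTracial`). For equal heights `T_y^* T_x` is `0`, some
`T_(b^k)` or its adjoint, which gives (2).

A KMS state satisfies this formula by the KMS condition for `T_x` and `T_y^*` and, for unequal
heights, by invariance. Conversely, the formula yields `ψ(f g) = e^(-βm) ψ(g f)` for `f = T_x T_y^*`
of degree `m` and every `g`: counting heights reduces this to powers of `b`. An arbitrary analytic
`f` with extension `F` is treated by Fourier series: `t ↦ ψ(F(t) g) - ψ(g F(t + iβ))` is continuous
and `2π`-periodic, and all its Fourier coefficients vanish after a shift of contour. -/

noncomputable section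

/-! ### Divisibility in the Baumslag-Solitar monoid -/

section BaumslagSolitar

/-- A bijection of `Fin c × (ℕ ⊕ ℕ)` with `Fin d × (ℕ ⊕ ℕ)` taking every pair with second component
in the left summand to such a pair with first component `0`. -/
theorem exists_equiv_map_inl (c d : ℕ) [NeZero c] [NeZero d] :
    ∃ σ : Fin c × (ℕ ⊕ ℕ) ≃ Fin d × (ℕ ⊕ ℕ), ∀ r n, ∃ n', σ (r, .inl n) = (0, .inl n') := by
  classical
  let s : Set (Fin c × (ℕ ⊕ ℕ)) := {p | p.2.isLeft}
  -- `Nat.pair` packs all `c` residues into a single copy of `ℕ`. The right summands leave infinite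
  -- complements on both sides, so this injection extends to a bijection.
  let f : s ↪ Fin d × (ℕ ⊕ ℕ) :=
    ⟨fun p => (0, .inl (Nat.pair p.1.1 (p.1.2.elim id id))), by
      rintro ⟨⟨r, n | n⟩, hr⟩ ⟨⟨r', n' | n'⟩, hr'⟩ h
      · simpa [Nat.pair_eq_pair, Fin.ext_iff] using h
      · cases hr'
      · cases hr
      · cases hr⟩
  have h1 : Infinite (sᶜ : Set (Fin c × (ℕ ⊕ ℕ))) :=
    Infinite.of_injective (fun n : ℕ => (⟨(0, .inr n), by simp [s]⟩ : (sᶜ : Set _)))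
      (fun m n h => by simpa using h)
  have h2 : Infinite ((Set.range f)ᶜ : Set (Fin d × (ℕ ⊕ ℕ))) :=
    Infinite.of_injective
      (fun n : ℕ => (⟨(0, .inr n), by rintro ⟨x, hx⟩; cases congrArg Prod.snd hx⟩ : ((Set.range f)ᶜ : Set _)))
      (fun m n h => by simpa using h)
  obtain ⟨σ, hσ⟩ := Cardinal.extend_function f nonempty_equiv_of_countable
  exact ⟨σ, fun r n => ⟨_, hσ ⟨(r, .inl n), rfl⟩⟩⟩

/-- The shift of the first component. -/
def shiftPerm (W : Type) : Equiv.Perm (ℤ × W) := (Equiv.addRight 1).prodCongr (Equiv.refl W)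

theorem shiftPerm_zpow {W : Type} (k m : ℤ) (w : W) : (shiftPerm W ^ k) (m, w) = (m + k, w) := by
  induction k with
  | zero => simp
  | succ k ih => rw [add_comm (k : ℤ), zpow_add, Equiv.Perm.mul_apply, ih]; simp [shiftPerm]; ring
  | pred k ih =>
    rw [sub_eq_add_neg, add_comm, zpow_add, Equiv.Perm.mul_apply, ih, zpow_neg_one,
      Equiv.Perm.inv_eq_iff_eq]
    simp [shiftPerm]; ring

theorem shiftPerm_pow {W : Type} (k : ℕ) (m : ℤ) (w : W) :
    (shiftPerm W ^ k) (m, w) = (m + k, w) := shiftPerm_zpow k m w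

/-- The permutation `(c m + r, w) ↦ (d m + s, w')`, where `(s, w') = σ (r, w)`. -/
def stretchPerm {c d : ℕ} [NeZero c] [NeZero d] {W : Type} (σ : Fin c × W ≃ Fin d × W) :
    Equiv.Perm (ℤ × W) :=
  ((Int.divModEquiv c).prodCongr (Equiv.refl W)).trans <| (Equiv.prodAssoc _ _ _).trans <|
    ((Equiv.refl ℤ).prodCongr σ).trans <| (Equiv.prodAssoc _ _ _).symm.trans <|
    ((Int.divModEquiv d).symm.prodCongr (Equiv.refl W))

theorem stretchPerm_apply {c d : ℕ} [NeZero c] [NeZero d] {W : Type}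
    (σ : Fin c × W ≃ Fin d × W) (m : ℤ) (r : Fin c) (w : W) :
    stretchPerm σ ((Int.divModEquiv c).symm (m, r), w) =
      ((Int.divModEquiv d).symm (m, (σ (r, w)).1), (σ (r, w)).2) := by
  simp only [stretchPerm, Equiv.trans_apply, Equiv.prodCongr_apply, Prod.map,
    Equiv.apply_symm_apply, Equiv.prodAssoc_apply, Equiv.prodAssoc_symm_apply, Equiv.refl_apply]

/-- Adding `c` to `c m + r` raises only the quotient `m`, and the quotient is afterwards multiplied
by `d`. Hence shift and stretch satisfy the defining relation of `BS c d`, for every `σ`. -/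
theorem stretchPerm_mul_shiftPerm_pow {c d : ℕ} [NeZero c] [NeZero d] {W : Type}
    (σ : Fin c × W ≃ Fin d × W) :
    stretchPerm σ * shiftPerm W ^ c = shiftPerm W ^ d * stretchPerm σ := by
  ext1 ⟨k, w⟩
  obtain ⟨⟨m, r⟩, rfl⟩ := (Int.divModEquiv c).symm.surjective k
  have h : (Int.divModEquiv c).symm (m, r) + c = (Int.divModEquiv c).symm (m + 1, r) := by
    simp [Int.divModEquiv]; ring
  rw [Equiv.Perm.mul_apply, Equiv.Perm.mul_apply, shiftPerm_pow, h, stretchPerm_apply,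
    stretchPerm_apply, shiftPerm_pow]
  simp [Int.divModEquiv]; ring

/-! ### Generators, the relation and the divisibility constraint -/

variable (c d : ℕ)

/-- The generator `a` of `BS(c, d)`. -/
def genA : BS c d := PresentedGroup.of .a

/-- The generator `b` of `BS(c, d)`. -/
def genB : BS c d := PresentedGroup.of .b

variable {c d}

theorem genA_mem : genA c d ∈ bsP c d := Submonoid.subset_closure (by simp [genA])

theorem genB_mem : genB c d ∈ bsP c d := Submonoid.subset_closure (by simp [genB])

theorem genB_pow_mem (n : ℕ) : genB c d ^ n ∈ bsP c d := pow_mem genB_mem n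

theorem bsP_induction {motive : (x : BS c d) → x ∈ bsP c d → Prop} (one : motive 1 (one_mem _))
    (mul_a : ∀ x hx, motive x hx → motive (genA c d * x) (mul_mem genA_mem hx))
    (mul_b : ∀ x hx, motive x hx → motive (genB c d * x) (mul_mem genB_mem hx))
    {x : BS c d} (hx : x ∈ bsP c d) : motive x hx := by
  induction hx using Submonoid.closure_induction_left with
  | one => exact one
  | mul_left s hs y hy ih =>
    rcases hs with rfl | rfl
    exacts [mul_a y hy ih, mul_b y hy ih]

theorem genA_mul_genB_pow : genA c d * genB c d ^ c = genB c d ^ d * genA c d := by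
  have h := PresentedGroup.one_of_mem (rels := bsRels c d) (Set.mem_singleton _)
  rw [map_mul, map_inv, mul_inv_eq_one] at h
  rw [map_mul, map_mul, map_pow, map_pow] at h
  exact h

theorem genA_mul_genB_pow_mul (m : ℕ) :
    genA c d * genB c d ^ (c * m) = genB c d ^ (d * m) * genA c d := by
  rw [pow_mul, pow_mul]
  exact SemiconjBy.pow_right (x := genB c d ^ c) genA_mul_genB_pow m

/-- The powers `b^i` with `0 ≤ i < d` have pairwise disjoint right ideals `b^i a P`. -/
theorem dvd_of_genA_mul_eq (hc : 0 < c) (hd : 0 < d) {p q : BS c d} (hp : p ∈ bsP c d)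
    (hq : q ∈ bsP c d) {i : ℕ} (h : genA c d * p = genB c d ^ i * (genA c d * q)) : d ∣ i := by
  have : NeZero c := ⟨hc.ne'⟩
  have : NeZero d := ⟨hd.ne'⟩
  obtain ⟨σ, hσ⟩ := exists_equiv_map_inl c d
  let F : BS c d →* Equiv.Perm (ℤ × (ℕ ⊕ ℕ)) :=
    PresentedGroup.toGroup (f := fun | .a => stretchPerm σ | .b => shiftPerm _)
      (by rintro r rfl; simp [stretchPerm_mul_shiftPerm_pow])
  have hFa : F (genA c d) = stretchPerm σ := PresentedGroup.toGroup.of _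
  have hFb : F (genB c d) = shiftPerm _ := PresentedGroup.toGroup.of _
  have ha : ∀ m n, ∃ m' n', stretchPerm σ (m, .inl n) = ((d : ℤ) * m', .inl n') := by
    intro k n
    obtain ⟨⟨m, r⟩, rfl⟩ := (Int.divModEquiv c).symm.surjective k
    obtain ⟨n', hn'⟩ := hσ r n
    refine ⟨m, n', ?_⟩
    rw [stretchPerm_apply, hn']
    simp [Int.divModEquiv, mul_comm]
  -- The set `ℤ × inl ℕ` is invariant under `P`, though not under `G`; only on it is the image of
  -- `a` known to lie over `dℤ`.
  have hU : ∀ p ∈ bsP c d, ∀ m n, ∃ m' n', F p (m, .inl n) = (m', .inl n') := by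
    intro p hp
    induction hp using bsP_induction with
    | one => exact fun m n => ⟨m, n, by simp⟩
    | mul_a x hx ih =>
      intro m n
      obtain ⟨m', n', h⟩ := ih m n
      obtain ⟨m'', n'', h'⟩ := ha m' n'
      exact ⟨_, n'', by rw [map_mul, Equiv.Perm.mul_apply, h, hFa, h']⟩
    | mul_b x hx ih =>
      intro m n
      obtain ⟨m', n', h⟩ := ih m n
      exact ⟨m' + 1, n', by
        rw [map_mul, Equiv.Perm.mul_apply, h, hFb]; simpa using shiftPerm_pow 1 m' _⟩
  obtain ⟨m, n, hpm⟩ := hU p hp 0 0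
  obtain ⟨m', n', hqm⟩ := hU q hq 0 0
  obtain ⟨k, l, hk⟩ := ha m n
  obtain ⟨k', l', hk'⟩ := ha m' n'
  -- Both sides move `(0, inl 0)`; the integer coordinates are `d k` and `d k' + i`.
  have := congrArg (fun g => F g (0, .inl 0)) h
  simp only [map_mul, Equiv.Perm.mul_apply, hpm, hqm, hFa, hk, hk', map_pow, hFb,
    shiftPerm_pow, Prod.mk.injEq] at this
  have h3 : (i : ℤ) = d * (k - k') := by linarith [this.1]
  exact Int.natCast_dvd_natCast.1 ⟨_, h3⟩

/-! #### Heights -/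

@[simp] theorem bsHeight_mul (x y : BS c d) :
    bsHeight c d (x * y) = bsHeight c d x + bsHeight c d y := by simp [bsHeight]

@[simp] theorem bsHeight_one : bsHeight c d 1 = 0 := by simp [bsHeight]

@[simp] theorem bsHeight_genA : bsHeight c d (genA c d) = 1 := by
  simp [bsHeight, bsHeightHom, genA]

@[simp] theorem bsHeight_genB : bsHeight c d (genB c d) = 0 := by
  simp [bsHeight, bsHeightHom, genB]

@[simp] theorem bsHeight_genB_pow (n : ℕ) : bsHeight c d (genB c d ^ n) = 0 := by
  induction n <;> simp_all [pow_succ]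

theorem bsHeight_nonneg {x : BS c d} (hx : x ∈ bsP c d) : 0 ≤ bsHeight c d x := by
  induction hx using bsP_induction with
  | one => simp
  | mul_a x _ ih => simp; omega
  | mul_b x _ ih => simpa

theorem eq_pow_or_eq_pow_mul_genA_mul {x : BS c d} (hx : x ∈ bsP c d) :
    (∃ k : ℕ, x = genB c d ^ k) ∨
      ∃ k : ℕ, ∃ y ∈ bsP c d, x = genB c d ^ k * (genA c d * y) := by
  induction hx using bsP_induction with
  | one => exact .inl ⟨0, by simp⟩
  | mul_a x hx _ => exact .inr ⟨0, x, hx, by simp⟩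
  | mul_b x _ ih =>
    rcases ih with ⟨k, rfl⟩ | ⟨k, y, hy, rfl⟩
    · exact .inl ⟨k + 1, (pow_succ' _ _).symm⟩
    · exact .inr ⟨k + 1, y, hy, by rw [pow_succ', mul_assoc]⟩

theorem exists_eq_pow_of_bsHeight_eq_zero {x : BS c d} (hx : x ∈ bsP c d)
    (h : bsHeight c d x = 0) : ∃ k : ℕ, x = genB c d ^ k := by
  rcases eq_pow_or_eq_pow_mul_genA_mul hx with h' | ⟨k, y, hy, rfl⟩
  · exact h'
  · have := bsHeight_nonneg hy
    simp at h
    omega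

/-! #### Joins -/

theorem PLe_mul_left_iff {G : Type} [Group G] {P : Submonoid G} (g x y : G) :
    PLe P (g * x) (g * y) ↔ PLe P x y := by
  simp [PLe, mul_assoc]

/-- There is a least power `b^n` with `x ≤ y b^n`, and it is below each `q ∈ P` with `x ≤ y q`. -/
def HasPowJoin (x y : BS c d) : Prop :=
  ∃ n : ℕ, PLe (bsP c d) x (y * genB c d ^ n) ∧
    ∀ q ∈ bsP c d, PLe (bsP c d) x (y * q) → PLe (bsP c d) (genB c d ^ n) q

/-- Left invariance is what permits cancelling common prefixes in the inductions on words. -/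
theorem hasPowJoin_mul_left_iff (g x y : BS c d) :
    HasPowJoin (g * x) (g * y) ↔ HasPowJoin x y := by
  simp only [HasPowJoin, mul_assoc, PLe_mul_left_iff]

theorem HasPowJoin.isJoin {x y : BS c d} (hy : y ∈ bsP c d) (h : HasPowJoin x y) :
    ∃ n : ℕ, IsJoin (bsP c d) x y (y * genB c d ^ n) := by
  obtain ⟨n, h1, h2⟩ := h
  refine ⟨n, mul_mem hy (genB_pow_mem n), h1, by simpa [PLe] using genB_pow_mem n, ?_⟩
  intro w _ hxw hyw
  have := h2 (y⁻¹ * w) hyw (by simpa using hxw)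
  rwa [← PLe_mul_left_iff y, mul_inv_cancel_left] at this

theorem hasPowJoin_one_left {y : BS c d} (hy : y ∈ bsP c d) : HasPowJoin 1 y :=
  ⟨0, by simpa [PLe] using hy, fun q hq _ => by simpa [PLe] using hq⟩

/-- The induction on `y` pushes the power of `b` through each letter. A letter `b` lowers the
exponent by one. A letter `a` rounds `i` up to the next multiple `d m₀` and turns it into `c m₀`,
since `b^i ≤ a z` amounts to `b^(c m₀) ≤ z`. -/
theorem hasPowJoin_pow_left (hc : 0 < c) (hd : 0 < d) {y : BS c d} (hy : y ∈ bsP c d) (i : ℕ) :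
    HasPowJoin (genB c d ^ i) y := by
  induction hy using bsP_induction generalizing i with
  | one => exact ⟨i, by simp [PLe, one_mem], fun q _ h => by simpa using h⟩
  | mul_b y hy ih =>
    cases i with
    | zero => simpa using hasPowJoin_one_left (mul_mem genB_mem hy)
    | succ i => rw [pow_succ', hasPowJoin_mul_left_iff]; exact ih i
  | mul_a y hy ih =>
    have hceil : ∀ m, i ⌈/⌉ d ≤ m ↔ i ≤ d * m := fun m => ceilDiv_le_iff_le_mul hd
    set m₀ := i ⌈/⌉ d
    obtain ⟨n, h1, h2⟩ := ih (c * m₀)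
    refine ⟨n, ?_, fun q hq h => h2 q hq ?_⟩
    · obtain ⟨k, hk⟩ := Nat.exists_eq_add_of_le ((hceil m₀).1 le_rfl)
      have h3 : (genB c d ^ i)⁻¹ * (genA c d * y * genB c d ^ n) =
          genB c d ^ k * (genA c d * ((genB c d ^ (c * m₀))⁻¹ * (y * genB c d ^ n))) := by
        rw [inv_mul_eq_iff_eq_mul, ← mul_assoc (_ ^ i), ← pow_add, ← hk, ← mul_assoc (_ ^ (d * m₀)),
          ← genA_mul_genB_pow_mul]
        simp [mul_assoc]
      rw [PLe, h3]
      exact mul_mem (genB_pow_mem k) (mul_mem genA_mem h1)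
    -- The quotient has height at least one, so it is not a power of `b`. It is thus `b^k a r`, and
    -- divisibility gives `i + k = d m`, whence `m₀ ≤ m`.
    · rcases eq_pow_or_eq_pow_mul_genA_mul h with ⟨k, hk⟩ | ⟨k, r, hr, hk⟩
      · have := congrArg (bsHeight c d) (inv_mul_eq_iff_eq_mul.1 hk)
        have := bsHeight_nonneg hy
        have := bsHeight_nonneg hq
        simp at *
        omega
      · rw [inv_mul_eq_iff_eq_mul, ← mul_assoc (_ ^ i), ← pow_add, mul_assoc] at hk
        obtain ⟨m, hm⟩ := dvd_of_genA_mul_eq hc hd (mul_mem hy hq) hr hk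
        rw [hm, ← mul_assoc (_ ^ _), ← genA_mul_genB_pow_mul, mul_assoc, mul_right_inj] at hk
        obtain ⟨k', hk'⟩ := Nat.exists_eq_add_of_le
          (Nat.mul_le_mul_left c ((hceil m).2 (by omega)))
        rw [PLe, hk, hk', pow_add, mul_assoc, inv_mul_cancel_left]
        exact mul_mem (genB_pow_mem k') hr

/-- Once the smaller leading power of `b` is cancelled, the common upper bound forces the remaining
power to be `b^(dm)`. It crosses `a` as `b^(cm)`, and cancelling that `a` lowers the height of `x`
by one. -/
theorem hasPowJoin_or_hasPowJoin (hc : 0 < c) (hd : 0 < d) (N : ℕ) {x y p q : BS c d}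
    (hx : x ∈ bsP c d) (hy : y ∈ bsP c d) (hp : p ∈ bsP c d) (hq : q ∈ bsP c d)
    (hN : bsHeight c d x = N) (h : x * p = y * q) : HasPowJoin x y ∨ HasPowJoin y x := by
  induction N generalizing x y p q with
  | zero =>
    obtain ⟨k, rfl⟩ := exists_eq_pow_of_bsHeight_eq_zero hx (by simpa using hN)
    exact .inl (hasPowJoin_pow_left hc hd hy k)
  | succ N ih =>
    rcases eq_pow_or_eq_pow_mul_genA_mul hx with ⟨i, rfl⟩ | ⟨i, x, hx', rfl⟩
    · exact .inl (hasPowJoin_pow_left hc hd hy i)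
    rcases eq_pow_or_eq_pow_mul_genA_mul hy with ⟨j, rfl⟩ | ⟨j, y, hy', rfl⟩
    · exact .inr (hasPowJoin_pow_left hc hd hx j)
    have hN' : bsHeight c d x = N := by simp at hN; omega
    rcases le_total i j with hij | hij
    · obtain ⟨k, rfl⟩ := Nat.exists_eq_add_of_le hij
      simp only [pow_add, mul_assoc, mul_right_inj] at h
      obtain ⟨m, rfl⟩ := dvd_of_genA_mul_eq hc hd (mul_mem hx' hp) (mul_mem hy' hq) h
      have e : genB c d ^ (d * m) * (genA c d * y) = genA c d * (genB c d ^ (c * m) * y) := by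
        rw [← mul_assoc, ← genA_mul_genB_pow_mul, mul_assoc]
      rw [← mul_assoc (_ ^ _), ← genA_mul_genB_pow_mul, mul_assoc, mul_right_inj,
        ← mul_assoc _ y] at h
      rw [pow_add, mul_assoc, e]
      simp only [hasPowJoin_mul_left_iff]
      exact ih hx' (mul_mem (genB_pow_mem _) hy') hp hq hN' h
    · obtain ⟨k, rfl⟩ := Nat.exists_eq_add_of_le hij
      simp only [pow_add, mul_assoc, mul_right_inj] at h
      obtain ⟨m, rfl⟩ := dvd_of_genA_mul_eq hc hd (mul_mem hy' hq) (mul_mem hx' hp) h.symm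
      have e : genB c d ^ (d * m) * (genA c d * x) = genA c d * (genB c d ^ (c * m) * x) := by
        rw [← mul_assoc, ← genA_mul_genB_pow_mul, mul_assoc]
      rw [← mul_assoc (_ ^ _), ← genA_mul_genB_pow_mul, mul_assoc, mul_right_inj,
        ← mul_assoc _ x] at h
      rw [pow_add, mul_assoc, e]
      simp only [hasPowJoin_mul_left_iff]
      exact ih (mul_mem (genB_pow_mem _) hx') hy' hp hq (by simpa using hN') h

theorem IsJoin.symm {G : Type} [Group G] {P : Submonoid G} {x y z : G} (h : IsJoin P x y z) :
    IsJoin P y x z :=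
  ⟨h.mem, h.right_le, h.left_le, fun w hw hy hx => h.least w hw hx hy⟩

/-- Two elements of `P` with a common upper bound have a join, which differs from one of them by a
power of `b`. -/
theorem exists_isJoin (hc : 0 < c) (hd : 0 < d) {x y : BS c d} (hx : x ∈ bsP c d)
    (hy : y ∈ bsP c d) (h : ¬ JoinInfinite (bsP c d) x y) :
    ∃ n : ℕ, IsJoin (bsP c d) x y (x * genB c d ^ n) ∨ IsJoin (bsP c d) x y (y * genB c d ^ n) := by
  rw [JoinInfinite, not_not] at h
  obtain ⟨w, -, hxw, hyw⟩ := h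
  obtain ⟨N, hN⟩ := Int.eq_ofNat_of_zero_le (bsHeight_nonneg hx)
  rcases hasPowJoin_or_hasPowJoin hc hd N hx hy hxw hyw hN (by simp) with h | h
  · obtain ⟨n, hn⟩ := h.isJoin hy
    exact ⟨n, .inr hn⟩
  · obtain ⟨n, hn⟩ := h.isJoin hx
    exact ⟨n, .inl hn.symm⟩

theorem isJoin_left_of_le {G : Type} [Group G] {P : Submonoid G} {x y : G} (hx : x ∈ P)
    (h : PLe P y x) : IsJoin P x y x :=
  ⟨hx, by simp [PLe, one_mem], h, fun _ _ h _ => h⟩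

/-- Elements of `P` of the same height are comparable as soon as they have an upper bound. -/
theorem isJoin_left_or_right (hc : 0 < c) (hd : 0 < d) {x y : BS c d} (hx : x ∈ bsP c d)
    (hy : y ∈ bsP c d) (hxy : bsHeight c d x = bsHeight c d y)
    (h : ¬ JoinInfinite (bsP c d) x y) :
    IsJoin (bsP c d) x y x ∨ IsJoin (bsP c d) x y y := by
  -- With equal heights, `y ≤ x b^n` means `x b^n = y b^k`; cancelling the smaller power on the
  -- right leaves a comparison of `x` and `y`.
  have key : ∀ {x y : BS c d}, x ∈ bsP c d → y ∈ bsP c d → bsHeight c d x = bsHeight c d y →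
      ∀ n : ℕ, PLe (bsP c d) y (x * genB c d ^ n) →
        PLe (bsP c d) x y ∨ PLe (bsP c d) y x := by
    intro x y hx hy hxy n h
    obtain ⟨k, hk⟩ := exists_eq_pow_of_bsHeight_eq_zero h (by
      have := congrArg (bsHeight c d) (mul_inv_cancel_left y (x * genB c d ^ n))
      simp only [bsHeight_mul, bsHeight_genB_pow] at this ⊢
      omega)
    rw [inv_mul_eq_iff_eq_mul] at hk
    rcases le_total n k with hnk | hnk
    · obtain ⟨l, rfl⟩ := Nat.exists_eq_add_of_le' hnk
      rw [pow_add, ← mul_assoc, mul_left_inj] at hk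
      right
      rw [hk, PLe, inv_mul_cancel_left]
      exact genB_pow_mem l
    · obtain ⟨l, rfl⟩ := Nat.exists_eq_add_of_le' hnk
      rw [pow_add, ← mul_assoc, mul_left_inj] at hk
      left
      rw [← hk, PLe, inv_mul_cancel_left]
      exact genB_pow_mem l
  obtain ⟨n, hn | hn⟩ := exists_isJoin hc hd hx hy h
  · rcases key hx hy hxy n hn.right_le with h | h
    · exact .inr (isJoin_left_of_le hy h).symm
    · exact .inl (isJoin_left_of_le hx h)
  · rcases key hy hx hxy.symm n hn.left_le with h | h
    · exact .inl (isJoin_left_of_le hx h)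
    · exact .inr (isJoin_left_of_le hy h).symm

end BaumslagSolitar
end

noncomputable section

/-! ### Products of the generating isometries -/

section Toeplitz

variable {G : Type} [Group G] {P : Submonoid G}

/-- Inserting `S_x^* S_x = 1` and `S_y^* S_y = 1` exposes the product of the range projections, to
which covariance applies. The projection of the join is then read as `S_(xu) S_(yv)^*`. -/
theorem IsNicaCovariant.star_mul {B : Type*} [CStarAlgebra B] {S : P →* B}
    (hS : IsNicaCovariant P S) {x y u v : P} (hxy : x * u = y * v)
    (h : IsJoin P (x : G) y (x * u : P)) : star (S x) * S y = S u * star (S v) := by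
  have hcov := hS.covariant x y (x * u) h
  nth_rw 2 [hxy] at hcov
  calc star (S x) * S y
      = star (S x) * S x * (star (S x) * S y) * (star (S y) * S y) := by simp [hS.isometry]
    _ = star (S x) * (S x * star (S x) * (S y * star (S y))) * S y := by noncomm_ring
    _ = star (S x) * S x * S u * star (S v) * (star (S y) * S y) := by
        rw [hcov, map_mul, map_mul, StarMul.star_mul]; noncomm_ring
    _ = S u * star (S v) := by simp [hS.isometry]

theorem IsNicaCovariant.star_mul_eq_zero {B : Type*} [CStarAlgebra B] {S : P →* B}
    (hS : IsNicaCovariant P S) {x y : P} (h : JoinInfinite P (x : G) y) :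
    star (S x) * S y = 0 := by
  have hcov := hS.covariant_infinite x y h
  calc star (S x) * S y
      = star (S x) * S x * (star (S x) * S y) * (star (S y) * S y) := by simp [hS.isometry]
    _ = star (S x) * (S x * star (S x) * (S y * star (S y))) * S y := by noncomm_ring
    _ = 0 := by simp [hcov]

theorem star_toeplitz_mul_self (x : P) : star (toeplitz P x) * toeplitz P x = 1 :=
  (toeplitz_isNicaCovariant P).isometry x

theorem star_toeplitz_mul_toeplitz_mul (x u : P) :
    star (toeplitz P x) * toeplitz P (x * u) = toeplitz P u := by
  rw [map_mul, ← mul_assoc, star_toeplitz_mul_self, one_mul]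

theorem star_toeplitz_mul_mul_toeplitz (x u : P) :
    star (toeplitz P (x * u)) * toeplitz P x = star (toeplitz P u) := by
  rw [← star_toeplitz_mul_toeplitz_mul x u, StarMul.star_mul, star_star]

variable (P) in
/-- The span of the elements `T_x T_y^*`. -/
def toeplitzSpan : Submodule ℂ (CStarGP P) :=
  Submodule.span ℂ (Set.range fun p : P × P => toeplitz P p.1 * star (toeplitz P p.2))

/-- The hypothesis moves adjoints to the right, so every monomial in the `T_x` and `T_x^*` is `0` or
a single `T_x T_y^*`. -/
theorem dense_toeplitzSpan
    (h : ∀ x y : P, star (toeplitz P x) * toeplitz P y = 0 ∨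
      ∃ u v : P, star (toeplitz P x) * toeplitz P y = toeplitz P u * star (toeplitz P v)) :
    Dense (toeplitzSpan P : Set (CStarGP P)) := by
  let s : Set (CStarGP P) := Set.range (toeplitz P)
  have hmon : ∀ w ∈ Submonoid.closure (s ∪ star s),
      w = 0 ∨ ∃ x y : P, w = toeplitz P x * star (toeplitz P y) := by
    intro w hw
    induction hw using Submonoid.closure_induction_left with
    | one => exact .inr ⟨1, 1, by simp⟩
    | mul_left g hg w _ ih =>
      rcases ih with rfl | ⟨p, q, rfl⟩
      · simp
      rcases hg with ⟨x, rfl⟩ | hg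
      · exact .inr ⟨x * p, q, by rw [map_mul, mul_assoc]⟩
      · obtain ⟨x, hx⟩ := hg
        rw [← star_star g, ← hx]
        rcases h x p with h0 | ⟨u, v, huv⟩
        · left; rw [← mul_assoc, h0, zero_mul]
        · right
          exact ⟨u, q * v, by rw [← mul_assoc, huv, map_mul, StarMul.star_mul, mul_assoc]⟩
  have hadj : ((StarAlgebra.adjoin ℂ s : StarSubalgebra ℂ (CStarGP P)) : Set (CStarGP P)) ⊆
      toeplitzSpan P := by
    intro w hw
    have hw' : w ∈ Subalgebra.toSubmodule (StarAlgebra.adjoin ℂ s).toSubalgebra := hw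
    rw [StarAlgebra.adjoin_toSubalgebra, Algebra.adjoin_eq_span] at hw'
    refine (Submodule.span_le.2 ?_) hw'
    intro w hw
    rcases hmon w hw with rfl | ⟨x, y, rfl⟩
    · exact zero_mem _
    · exact Submodule.subset_span ⟨(x, y), rfl⟩
  have hmap : StarAlgebra.adjoin ℂ (Set.range (productRep P)) ≤
      (StarAlgebra.adjoin ℂ s).map (cstarGP P).subtype := by
    refine StarAlgebra.adjoin_le ?_
    rintro _ ⟨x, rfl⟩
    exact ⟨toeplitz P x, StarAlgebra.subset_adjoin ℂ _ ⟨x, rfl⟩, rfl⟩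
  intro a
  rw [closure_subtype]
  refine closure_mono ?_ a.2
  intro w hw
  obtain ⟨v, hv, rfl⟩ := hmap hw
  exact ⟨v, hadj hv, rfl⟩

end Toeplitz

/-! ### States -/

section State

open scoped ComplexOrder

variable {A : Type*} [CStarAlgebra A]

/-- Polarization: `ψ` is real on `a^* a`, `(a + 1)^* (a + 1)` and `(a + i)^* (a + i)`, which relates
the imaginary and the real parts of `ψ(a)` and `ψ(a^*)`. -/
theorem IsState.map_star {ψ : A →L[ℂ] ℂ} (hψ : IsState ψ) (a : A) :
    ψ (star a) = (starRingEnd ℂ) (ψ a) := by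
  have h0 := (Complex.nonneg_iff.1 (hψ.nonneg a)).2
  have h1 := (Complex.nonneg_iff.1 (hψ.nonneg (a + 1))).2
  have h2 := (Complex.nonneg_iff.1 (hψ.nonneg (a + Complex.I • 1))).2
  simp only [star_add, star_one, star_smul, mul_add, add_mul, mul_one, one_mul, map_add,
    smul_mul_assoc, mul_smul_comm, map_smul, hψ.map_one, Complex.add_im, smul_eq_mul,
    Complex.mul_im, Complex.I_re, Complex.I_im, Complex.star_def, Complex.conj_I,
    Complex.neg_re, Complex.neg_im, Complex.one_im] at h0 h1 h2
  apply Complex.ext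
  · rw [Complex.conj_re]; linarith
  · rw [Complex.conj_im]; linarith

end State

/-! ### The generating isometries of the Baumslag-Solitar monoid -/

section BaumslagSolitar

variable {c d : ℕ}

/-- The join is `x b^n` or `y b^n`, so one of `u`, `v` is a power of `b`. This height condition is
what makes the later degree counts work. -/
theorem star_toeplitz_mul_toeplitz (hc : 0 < c) (hd : 0 < d) (x y : bsP c d) :
    star (toeplitz _ x) * toeplitz _ y = 0 ∨ ∃ u v : bsP c d, x * u = y * v ∧
      (bsHeight c d u = 0 ∨ bsHeight c d v = 0) ∧
      star (toeplitz _ x) * toeplitz _ y = toeplitz _ u * star (toeplitz _ v) := by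
  by_cases h : JoinInfinite (bsP c d) (x : BS c d) y
  · exact .inl ((toeplitz_isNicaCovariant _).star_mul_eq_zero h)
  right
  obtain ⟨n, h | h⟩ := exists_isJoin hc hd x.2 y.2 h
  · have e : x * ⟨_, genB_pow_mem n⟩ = y * ⟨_, h.right_le⟩ := by ext; simp
    exact ⟨_, _, e, .inl (bsHeight_genB_pow n), (toeplitz_isNicaCovariant _).star_mul e h⟩
  · have e : x * ⟨_, h.left_le⟩ = y * ⟨_, genB_pow_mem n⟩ := by ext; simp
    refine ⟨_, _, e, .inr (bsHeight_genB_pow n), (toeplitz_isNicaCovariant _).star_mul e ?_⟩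
    rw [e]
    exact h

theorem dense_toeplitzSpan_bsP (hc : 0 < c) (hd : 0 < d) :
    Dense (toeplitzSpan (bsP c d) : Set (CStarGP (bsP c d))) :=
  dense_toeplitzSpan fun x y => (star_toeplitz_mul_toeplitz hc hd x y).imp_right
    fun ⟨u, v, _, _, h⟩ => ⟨u, v, h⟩

theorem exists_eq_bsB_pow {x : bsP c d} (h : bsHeight c d x = 0) : ∃ k : ℕ, x = bsB c d ^ k := by
  obtain ⟨k, hk⟩ := exists_eq_pow_of_bsHeight_eq_zero x.2 h
  exact ⟨k, Subtype.ext (by rw [hk]; rfl)⟩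

@[simp] theorem bsHeight_bsB_pow (k : ℕ) : bsHeight c d (bsB c d ^ k : bsP c d) = 0 :=
  bsHeight_genB_pow k

/-- The functional `ψ` satisfies the KMS condition on the pairs `T_x`, `T_y^*` of equal height, and
vanishes on the `T_x T_y^*` of nonzero degree. -/
def IsHeightTracial (c d : ℕ) (β : ℝ) (ψ : CStarGP (bsP c d) →L[ℂ] ℂ) : Prop :=
  ∀ x y : bsP c d, ψ (toeplitz _ x * star (toeplitz _ y)) =
    if bsHeight c d x = bsHeight c d y then
      (Real.exp (-β * bsHeight c d x) : ℂ) * ψ (star (toeplitz _ y) * toeplitz _ x) else 0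

theorem toeplitz_quotient_of_right_le {x y : bsP c d} (h : PLe (bsP c d) (y : BS c d) x) :
    star (toeplitz _ y) * toeplitz _ x = toeplitz _ ⟨(y : BS c d)⁻¹ * x, h⟩ := by
  have e : x = y * ⟨(y : BS c d)⁻¹ * x, h⟩ := Subtype.ext (mul_inv_cancel_left _ _).symm
  rw [← star_toeplitz_mul_toeplitz_mul y ⟨_, h⟩, ← e]

theorem toeplitz_quotient_of_left_le {x y : bsP c d} (h : PLe (bsP c d) (x : BS c d) y) :
    star (toeplitz _ y) * toeplitz _ x = star (toeplitz _ ⟨(x : BS c d)⁻¹ * y, h⟩) := by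
  rw [← toeplitz_quotient_of_right_le h, StarMul.star_mul, star_star]

/-- For equal heights, comparability leaves three values for `T_y^* T_x`: `T_(y⁻¹x)`, `T_(x⁻¹y)^*`,
or `0` when there is no upper bound. These are the three cases of the formula. -/
theorem isHeightTracial_iff (hc : 0 < c) (hd : 0 < d) (β : ℝ)
    (ψ : CStarGP (bsP c d) →L[ℂ] ℂ) :
    IsHeightTracial c d β ψ ↔ ∀ x y : bsP c d,
      (bsHeight c d x = bsHeight c d y → ∀ h : IsJoin (bsP c d) (x : BS c d) y x,
        ψ (toeplitz (bsP c d) x * star (toeplitz (bsP c d) y)) =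
          (Real.exp (-β * bsHeight c d x) : ℂ) *
            ψ (toeplitz (bsP c d) ⟨(y : BS c d)⁻¹ * x, h.right_le⟩)) ∧
      (bsHeight c d x = bsHeight c d y → ∀ h : IsJoin (bsP c d) (x : BS c d) y y,
        ψ (toeplitz (bsP c d) x * star (toeplitz (bsP c d) y)) =
          (Real.exp (-β * bsHeight c d x) : ℂ) *
            ψ (star (toeplitz (bsP c d) ⟨(x : BS c d)⁻¹ * y, h.left_le⟩))) ∧
      (¬ (bsHeight c d x = bsHeight c d y ∧
          (IsJoin (bsP c d) (x : BS c d) y x ∨ IsJoin (bsP c d) (x : BS c d) y y)) →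
        ψ (toeplitz (bsP c d) x * star (toeplitz (bsP c d) y)) = 0) := by
  refine forall₂_congr fun x y => ?_
  by_cases hxy : bsHeight c d x = bsHeight c d y
  · simp only [hxy, if_true, true_imp_iff, true_and]
    constructor
    · intro H
      refine ⟨fun h => ?_, fun h => ?_, fun h => ?_⟩
      · rw [H, toeplitz_quotient_of_right_le h.right_le]
      · rw [H, toeplitz_quotient_of_left_le h.left_le]
      · have hinf : JoinInfinite (bsP c d) (y : BS c d) x := by
          rintro ⟨w, hw, hyw, hxw⟩
          exact h (isJoin_left_or_right hc hd x.2 y.2 hxy fun h => h ⟨w, hw, hxw, hyw⟩)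
        rw [H, (toeplitz_isNicaCovariant _).star_mul_eq_zero hinf, map_zero, mul_zero]
    · rintro ⟨h1, h2, h3⟩
      by_cases hinf : JoinInfinite (bsP c d) (x : BS c d) y
      · have hinf' : JoinInfinite (bsP c d) (y : BS c d) x := by
          rintro ⟨w, hw, hyw, hxw⟩
          exact hinf ⟨w, hw, hxw, hyw⟩
        rw [(toeplitz_isNicaCovariant _).star_mul_eq_zero hinf', map_zero, mul_zero]
        refine h3 ?_
        rintro (h | h)
        · exact hinf ⟨_, h.mem, h.left_le, h.right_le⟩
        · exact hinf ⟨_, h.mem, h.left_le, h.right_le⟩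
      · rcases isJoin_left_or_right hc hd x.2 y.2 hxy hinf with h | h
        · rw [h1 h, toeplitz_quotient_of_right_le h.right_le]
        · rw [h2 h, toeplitz_quotient_of_left_le h.left_le]
  · simp [hxy]

/-! ### Consequences of the height-tracial formula -/

variable {β : ℝ} {ψ φ : CStarGP (bsP c d) →L[ℂ] ℂ}

/-- A height-tracial state is tracial on the products of three elements of `b^ℕ`. -/
theorem IsHeightTracial.map_bsB_pow_mul (h : IsHeightTracial c d β ψ) (m k l : ℕ) :
    ψ (toeplitz _ (bsB c d ^ m) * (toeplitz _ (bsB c d ^ k) * star (toeplitz _ (bsB c d ^ l)))) =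
      ψ (toeplitz _ (bsB c d ^ k) * star (toeplitz _ (bsB c d ^ l)) * toeplitz _ (bsB c d ^ m)) := by
  rw [← mul_assoc, ← map_mul, ← pow_add, h]
  simp only [bsHeight_bsB_pow, if_true, Int.cast_zero, mul_zero, Real.exp_zero, Complex.ofReal_one,
    one_mul]
  rcases le_total l m with hl | hl
  · obtain ⟨n, rfl⟩ := Nat.exists_eq_add_of_le hl
    rw [add_assoc, pow_add, star_toeplitz_mul_toeplitz_mul, mul_assoc, pow_add _ l n,
      star_toeplitz_mul_toeplitz_mul, ← map_mul, ← pow_add, add_comm n k]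
  · obtain ⟨n, rfl⟩ := Nat.exists_eq_add_of_le hl
    rw [mul_assoc, pow_add, pow_add, star_toeplitz_mul_mul_toeplitz, h]
    simp only [bsHeight_bsB_pow, if_true, Int.cast_zero, mul_zero, Real.exp_zero,
      Complex.ofReal_one, one_mul]
    rw [map_mul (toeplitz _), map_mul (toeplitz _), StarMul.star_mul, mul_assoc,
      ← mul_assoc _ (toeplitz _ (bsB c d ^ m)),
      star_toeplitz_mul_self, one_mul]

/-- With `T_q^* T_x = T_u T_v^*`, applying the formula to both sides reduces the claim to `ψ(T_u
T_v^* T_p) = ψ(T_v^* T_p T_u)`. If the total degree is zero, `u` is a power of `b` and `v`, `p` have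
equal height, so only powers of `b` remain. -/
theorem IsHeightTracial.map_toeplitz_mul_span (hc : 0 < c) (hd : 0 < d)
    (h : IsHeightTracial c d β ψ) (x p q : bsP c d) :
    ψ (toeplitz _ x * (toeplitz _ p * star (toeplitz _ q))) =
      (Real.exp (-β * bsHeight c d x) : ℂ) *
        ψ (toeplitz _ p * star (toeplitz _ q) * toeplitz _ x) := by
  have hp := bsHeight_nonneg p.2
  rw [← mul_assoc, ← map_mul, h, map_mul (toeplitz _), ← mul_assoc, mul_assoc (toeplitz _ p)]
  rcases star_toeplitz_mul_toeplitz hc hd q x with h0 | ⟨u, v, huv, hz, e⟩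
  · simp [h0]
  have hH : bsHeight c d q + bsHeight c d u = bsHeight c d x + bsHeight c d v := by
    simpa using congrArg (fun g : bsP c d => bsHeight c d g) huv
  have hu := bsHeight_nonneg u.2
  rw [e, ← mul_assoc, ← map_mul, h]
  simp only [Submonoid.coe_mul, bsHeight_mul]
  by_cases hcond : bsHeight c d x + bsHeight c d p = bsHeight c d q
  swap
  · rw [if_neg hcond, if_neg (by omega), mul_zero]
  rw [if_pos hcond, if_pos (by omega), ← mul_assoc, ← Complex.ofReal_mul, ← Real.exp_add,
    map_mul (toeplitz _), ← mul_assoc, mul_assoc (toeplitz _ u)]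
  -- Zero degree gives `θ(v) = θ(p) + θ(u)`; if `θ(v) = 0`, then `θ(u) = 0` as well, because heights
  -- are nonnegative.
  have hu0 : bsHeight c d u = 0 := by omega
  have hpv : bsHeight c d p = bsHeight c d v := by omega
  congr 1
  · rw [hu0]; push_cast; ring_nf
  · rcases star_toeplitz_mul_toeplitz hc hd v p with h0 | ⟨r, s, hrs, hz', e'⟩
    · simp [h0]
    have hH' : bsHeight c d v + bsHeight c d r = bsHeight c d p + bsHeight c d s := by
      simpa using congrArg (fun g : bsP c d => bsHeight c d g) hrs
    obtain ⟨m, rfl⟩ := exists_eq_bsB_pow hu0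
    obtain ⟨k, rfl⟩ := exists_eq_bsB_pow (x := r) (by omega)
    obtain ⟨l, rfl⟩ := exists_eq_bsB_pow (x := s) (by omega)
    rw [e', h.map_bsB_pow_mul]

theorem IsHeightTracial.map_toeplitz_mul (hc : 0 < c) (hd : 0 < d)
    (h : IsHeightTracial c d β ψ) (x : bsP c d) (g : CStarGP (bsP c d)) :
    ψ (toeplitz _ x * g) = (Real.exp (-β * bsHeight c d x) : ℂ) * ψ (g * toeplitz _ x) := by
  revert g
  rw [← funext_iff]
  refine Continuous.ext_on (dense_toeplitzSpan_bsP hc hd) (by fun_prop) (by fun_prop) ?_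
  intro g hg
  induction hg using Submodule.span_induction with
  | mem g hg => obtain ⟨⟨p, q⟩, rfl⟩ := hg; exact h.map_toeplitz_mul_span hc hd x p q
  | zero => simp
  | add f g _ _ hf hg => simp only [mul_add, add_mul, map_add, hf, hg]
  | smul t g _ hg =>
    simp only [mul_smul_comm, smul_mul_assoc, map_smul, hg, smul_eq_mul]; ring

theorem IsHeightTracial.map_toeplitz_mul_star_mul (hc : 0 < c) (hd : 0 < d) (hψ : IsState ψ)
    (h : IsHeightTracial c d β ψ) (x y : bsP c d) (g : CStarGP (bsP c d)) :
    ψ (toeplitz _ x * star (toeplitz _ y) * g) =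
      (Real.exp (-β * (bsHeight c d x - bsHeight c d y : ℤ)) : ℂ) *
        ψ (g * (toeplitz _ x * star (toeplitz _ y))) := by
  -- Conjugating the identity for `T_y` gives the one for `T_y^*`, with the inverse exponential
  -- factor.
  have hstar : ∀ g, ψ (star (toeplitz _ y) * g) =
      (Real.exp (β * bsHeight c d y) : ℂ) * ψ (g * star (toeplitz _ y)) := by
    intro g
    have h1 := congrArg (starRingEnd ℂ) (h.map_toeplitz_mul hc hd y (star g))
    rw [map_mul (starRingEnd ℂ), ← hψ.map_star, ← hψ.map_star, Complex.conj_ofReal] at h1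
    simp only [StarMul.star_mul, star_star] at h1
    rw [h1, ← mul_assoc, ← Complex.ofReal_mul, ← Real.exp_add]
    simp
  rw [mul_assoc, h.map_toeplitz_mul hc hd, mul_assoc, hstar, ← mul_assoc, ← Complex.ofReal_mul,
    ← Real.exp_add, mul_assoc]
  congr 3
  push_cast; ring_nf

/-- A height-tracial functional is determined by its values at the powers of `T_b`. -/
theorem IsHeightTracial.ext (hc : 0 < c) (hd : 0 < d) (hφ : IsState φ) (hψ : IsState ψ)
    (h : IsHeightTracial c d β φ) (h' : IsHeightTracial c d β ψ)
    (hb : ∀ t : ℕ, φ (toeplitz _ (bsB c d ^ t)) = ψ (toeplitz _ (bsB c d ^ t))) : φ = ψ := by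
  refine DFunLike.coe_injective
    (Continuous.ext_on (dense_toeplitzSpan_bsP hc hd) φ.continuous ψ.continuous ?_)
  intro g hg
  induction hg using Submodule.span_induction with
  | zero => simp
  | add f g _ _ hf hg => rw [map_add, map_add, hf, hg]
  | smul t g _ hg => rw [map_smul, map_smul, hg]
  | mem g hg =>
    obtain ⟨⟨x, y⟩, rfl⟩ := hg
    dsimp only
    rw [h, h']
    split_ifs with hxy
    · congr 1
      -- At equal heights `T_y^* T_x` is `0`, a power of `T_b`, or the adjoint of one; states
      -- respect adjoints.
      by_cases hinf : JoinInfinite (bsP c d) (y : BS c d) x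
      · simp [(toeplitz_isNicaCovariant _).star_mul_eq_zero hinf]
      · rcases isJoin_left_or_right hc hd y.2 x.2 hxy.symm hinf with hj | hj
        · have hle := hj.right_le
          rw [toeplitz_quotient_of_left_le hle, hφ.map_star, hψ.map_star]
          obtain ⟨k, hk⟩ := exists_eq_bsB_pow (x := ⟨_, hle⟩) (by
            have := congrArg (bsHeight c d) (mul_inv_cancel_left (x : BS c d) y)
            simp only [bsHeight_mul] at this ⊢
            omega)
          rw [hk, hb]
        · have hle := hj.left_le
          rw [toeplitz_quotient_of_right_le hle]
          obtain ⟨k, hk⟩ := exists_eq_bsB_pow (x := ⟨_, hle⟩) (by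
            have := congrArg (bsHeight c d) (mul_inv_cancel_left (y : BS c d) x)
            simp only [bsHeight_mul] at this ⊢
            omega)
          rw [hk, hb]
    · rfl

end BaumslagSolitar
end

noncomputable section

/-! ### Entire functions that are periodic on the real line -/

section Periodic

open Complex MeasureTheory intervalIntegral Real

theorem Differentiable.eq_of_eqOn_real {f g : ℂ → ℂ} (hf : Differentiable ℂ f)
    (hg : Differentiable ℂ g) (h : ∀ t : ℝ, f t = g t) : f = g := by
  have hf' : AnalyticOnNhd ℂ f Set.univ := fun z _ => hf.analyticAt z
  have hg' : AnalyticOnNhd ℂ g Set.univ := fun z _ => hg.analyticAt z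
  refine hf'.eq_of_frequently_eq (z₀ := 0) hg' ?_
  have h1 : Filter.Tendsto (fun t : ℝ => (t : ℂ)) (nhdsWithin 0 {0}ᶜ) (nhdsWithin 0 {0}ᶜ) := by
    refine Filter.Tendsto.inf ?_ ?_
    · exact Complex.continuous_ofReal.tendsto' 0 0 Complex.ofReal_zero
    · simp
  exact h1.frequently (Filter.Frequently.of_forall h)

/-- The contour of the Fourier integrals of a periodic entire function can be shifted. -/
theorem integral_exp_mul_add_I_mul {h : ℂ → ℂ} (hh : Differentiable ℂ h)
    (hper : ∀ t : ℝ, h (t + 2 * π) = h t) (β : ℝ) (n : ℤ) :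
    ∫ t : ℝ in (0)..(2 * π), cexp (-(n * t * I)) * h (t + I * β) =
      (rexp (-β * n) : ℂ) * ∫ t : ℝ in (0)..(2 * π), cexp (-(n * t * I)) * h t := by
  have hper' : ∀ z : ℂ, h (z + 2 * π) = h z := congrFun <|
    Differentiable.eq_of_eqOn_real (f := fun z => h (z + 2 * π)) (by fun_prop) hh hper
  let k : ℂ → ℂ := fun z => cexp (-(n * z * I)) * h z
  have hk : Differentiable ℂ k := by fun_prop
  have hkper : ∀ z : ℂ, k (z + 2 * π) = k z := fun z => by
    have : -(n * (z + 2 * π) * I) = -(n * z * I) - n * (2 * π * I) := by ring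
    simp only [k, hper', this, Complex.exp_periodic.sub_int_mul_eq]
  -- Periodicity makes the two vertical sides of the rectangle cancel, so the integrals of `k` over
  -- the horizontal sides agree.
  have hrect := Complex.integral_boundary_rect_eq_zero_of_differentiableOn k 0 (2 * π + β * I)
    hk.differentiableOn
  have hside : ∀ y : ℝ, k (2 * π + y * I) = k (y * I) := fun y => by rw [add_comm, hkper]
  simp only [zero_re, zero_im, ofReal_zero, zero_mul, add_zero, zero_add, add_re, mul_re, add_im,
    mul_im, I_re, I_im, ofReal_re, ofReal_im, re_ofNat, im_ofNat, mul_zero, mul_one, sub_zero,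
    ofReal_mul, ofReal_ofNat, hside, sub_eq_zero, add_sub_cancel_right, sub_self] at hrect
  rw [show ∫ t : ℝ in (0)..(2 * π), cexp (-(n * t * I)) * h t = ∫ t : ℝ in (0)..(2 * π), k t
    from rfl, hrect, ← intervalIntegral.integral_const_mul]
  refine integral_congr fun t _ => ?_
  simp only [k, ofReal_exp]
  rw [← mul_assoc, ← Complex.exp_add, mul_comm I (β : ℂ)]
  congr 2
  push_cast
  linear_combination ((β : ℂ) * n) * I_mul_I

/-- The Fourier coefficients, being all zero, are summable, so the Fourier series converges
pointwise to the function. -/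
theorem Continuous.eq_zero_of_integral_exp_mul_eq_zero {D : ℝ → ℂ} (hD : Continuous D)
    (hper : Function.Periodic D (2 * π))
    (h : ∀ n : ℤ, ∫ t : ℝ in (0)..(2 * π), cexp (-(n * t * I)) * D t = 0) (t : ℝ) : D t = 0 := by
  have : Fact (0 < 2 * π) := ⟨two_pi_pos⟩
  let f : C(AddCircle (2 * π), ℂ) := ⟨hper.lift, continuous_coinduced_dom.2 hD⟩
  have hcoeff : fourierCoeff f = 0 := by
    ext n
    rw [fourierCoeff_eq_intervalIntegral f n 0, zero_add]
    have : ∀ t : ℝ, fourier (-n) (t : AddCircle (2 * π)) • f t = cexp (-(n * t * I)) * D t := by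
      intro t
      rw [fourier_coe_apply, smul_eq_mul]
      congr 2
      push_cast
      have : (π : ℂ) ≠ 0 := by exact_mod_cast pi_ne_zero
      field_simp
    simp only [this, h, smul_zero, Pi.zero_apply]
  have hsum := has_pointwise_sum_fourier_series_of_summable (f := f)
    (by rw [hcoeff]; exact summable_zero) t
  simp only [hcoeff, Pi.zero_apply, zero_smul] at hsum
  exact hsum.unique hasSum_zero

theorem integral_exp_int_mul {m : ℤ} (hm : m ≠ 0) :
    ∫ t : ℝ in (0)..(2 * π), cexp (m * t * I) = 0 := by
  have hmI : (m * I : ℂ) ≠ 0 := mul_ne_zero (by exact_mod_cast hm) I_ne_zero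
  have := integral_exp_mul_complex (a := 0) (b := 2 * π) hmI
  have e : ∀ t : ℝ, (m * t * I : ℂ) = m * I * t := fun t => by ring
  simp only [e, this]
  have : (m * I * (2 * π : ℝ) : ℂ) = m * (2 * π * I) := by push_cast; ring
  rw [this, Complex.exp_int_mul_two_pi_mul_I]
  simp

end Periodic

/-! ### The dynamics -/

section Dynamics

open Complex

variable {c d : ℕ}

theorem bsDynamics_toeplitz (t : ℝ) (x : bsP c d) :
    bsDynamics c d t (toeplitz _ x) = cexp (bsHeight c d x * t * I) • toeplitz _ x := by
  rw [bsDynamics, bsGauge_toeplitz, Circle.coe_zpow, Circle.coe_exp, ← Complex.exp_int_mul,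
    mul_assoc]

theorem bsDynamics_toeplitz_mul_star (t : ℝ) (x y : bsP c d) :
    bsDynamics c d t (toeplitz _ x * star (toeplitz _ y)) =
      cexp ((bsHeight c d x - bsHeight c d y : ℤ) * t * I) •
        (toeplitz _ x * star (toeplitz _ y)) := by
  rw [map_mul, map_star, bsDynamics_toeplitz, bsDynamics_toeplitz, star_smul, smul_mul_assoc,
    mul_smul_comm, smul_smul, Complex.star_def, ← Complex.exp_conj, ← Complex.exp_add]
  congr 2
  simp only [map_mul, map_intCast, conj_ofReal, conj_I]
  push_cast
  ring

theorem bsDynamics_add_two_pi (t : ℝ) :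
    bsDynamics c d (t + 2 * Real.pi) = bsDynamics c d t := by
  rw [bsDynamics, bsDynamics, Circle.periodic_exp t]

theorem norm_bsDynamics_le (t : ℝ) (f : CStarGP (bsP c d)) : ‖bsDynamics c d t f‖ ≤ ‖f‖ :=
  NonUnitalStarAlgHom.norm_apply_le (bsDynamics c d t) f

theorem isEntireExtension_toeplitz_mul_star (x y : bsP c d) :
    IsEntireExtension (bsDynamics c d) (toeplitz _ x * star (toeplitz _ y)) fun z =>
      cexp ((bsHeight c d x - bsHeight c d y : ℤ) * z * I) •
        (toeplitz _ x * star (toeplitz _ y)) :=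
  ⟨by fun_prop, fun t => (bsDynamics_toeplitz_mul_star t x y).symm⟩

theorem cexp_int_mul_I_mul_mul_I (n : ℤ) (β : ℝ) :
    cexp (n * (I * β) * I) = (Real.exp (-β * n) : ℂ) := by
  rw [ofReal_exp]
  congr 1
  push_cast
  linear_combination (β : ℂ) * n * I_mul_I

/-! ### Equivalence of the KMS condition and the height-tracial formula -/

variable {β : ℝ} {ψ : CStarGP (bsP c d) →L[ℂ] ℂ}

theorem IsKMSState.isHeightTracial (h : IsKMSState (bsDynamics c d) β ψ) :
    IsHeightTracial c d β ψ := by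
  intro x y
  split_ifs with hxy
  · have hx := isEntireExtension_toeplitz_mul_star x 1
    have hy := isEntireExtension_toeplitz_mul_star 1 y
    have := h.kms _ _ _ hx ⟨_, hy⟩
    rw [cexp_int_mul_I_mul_mul_I] at this
    simpa using this
  · have hn : bsHeight c d x - bsHeight c d y ≠ 0 := sub_ne_zero.2 hxy
    set n := bsHeight c d x - bsHeight c d y with hn'
    -- For `β = 0` the time `π / n` changes the sign of an element of degree `n`. For `β ≠ 0` the
    -- KMS condition against `1 = T_1 T_1^*` gives `ψ(f) = e^(-βn) ψ(f)` with a factor different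
    -- from one.
    by_cases hβ : β = 0
    · have hinv := h.invariant hβ (Real.pi / n) (toeplitz _ x * star (toeplitz _ y))
      rw [bsDynamics_toeplitz_mul_star, map_smul, ← hn', smul_eq_mul] at hinv
      have e : (n * (Real.pi / n : ℝ) * I : ℂ) = Real.pi * I := by
        have : (n : ℂ) ≠ 0 := by exact_mod_cast hn
        push_cast
        field_simp
      rw [e, Complex.exp_pi_mul_I, neg_one_mul] at hinv
      exact self_eq_neg.1 hinv.symm
    · have h1 := isEntireExtension_toeplitz_mul_star (1 : bsP c d) 1
      have hkms := h.kms _ _ _ (isEntireExtension_toeplitz_mul_star x y) ⟨_, h1⟩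
      rw [cexp_int_mul_I_mul_mul_I, ← hn'] at hkms
      simp only [map_one, star_one, mul_one, one_mul, map_smul, smul_eq_mul] at hkms
      by_contra h0
      have h2 := (mul_eq_right₀ h0).1 hkms.symm
      rw [ofReal_eq_one, Real.exp_eq_one_iff] at h2
      exact mul_ne_zero (neg_ne_zero.2 hβ) (Int.cast_ne_zero.2 hn) h2

/-- The Fourier integrals of `t ↦ ψ(α_t(f) g)` and `t ↦ ψ(g α_t(f))` for `f` in the span of the
`T_x T_y^*`. -/
theorem IsHeightTracial.integral_of_mem_span (hc : 0 < c) (hd : 0 < d) (hψ : IsState ψ)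
    (h : IsHeightTracial c d β ψ) (g : CStarGP (bsP c d)) (n : ℤ) {f : CStarGP (bsP c d)}
    (hf : f ∈ toeplitzSpan (bsP c d)) :
    Continuous (fun t => bsDynamics c d t f) ∧
    ∫ t : ℝ in (0)..(2 * Real.pi), cexp (-(n * t * I)) *
      (ψ (bsDynamics c d t f * g) - Real.exp (-β * n) * ψ (g * bsDynamics c d t f)) = 0 := by
  induction hf using Submodule.span_induction with
  | zero => simp [continuous_const]
  | add f₁ f₂ _ _ h₁ h₂ =>
    obtain ⟨c₁, h₁⟩ := h₁
    obtain ⟨c₂, h₂⟩ := h₂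
    refine ⟨by simp only [map_add]; exact c₁.add c₂, ?_⟩
    refine Eq.trans ?_ ((congrArg₂ (· + ·) h₁ h₂).trans (add_zero 0))
    rw [← intervalIntegral.integral_add]
    · refine intervalIntegral.integral_congr fun t _ => ?_
      simp only [map_add, add_mul, mul_add]
      ring
    all_goals exact Continuous.intervalIntegrable (by fun_prop) _ _
  | smul s f _ hf =>
    obtain ⟨cf, hf⟩ := hf
    refine ⟨by simp only [map_smul]; exact cf.const_smul s, ?_⟩
    rw [← mul_zero s, ← hf, ← intervalIntegral.integral_const_mul]
    refine intervalIntegral.integral_congr fun t _ => ?_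
    simp only [map_smul, smul_mul_assoc, mul_smul_comm, smul_eq_mul]
    ring
  | mem f hf =>
    obtain ⟨⟨x, y⟩, rfl⟩ := hf
    simp only [bsDynamics_toeplitz_mul_star]
    refine ⟨by fun_prop, ?_⟩
    set m := bsHeight c d x - bsHeight c d y with hm
    -- An element of degree `m` contributes a multiple of `e^(i(m-n)t) (e^(-βm) - e^(-βn))`: the
    -- second factor vanishes if `m = n`, the integral of the first otherwise.
    have e : ∀ t : ℝ, cexp (-(n * t * I)) *
        (ψ (cexp (m * t * I) • (toeplitz _ x * star (toeplitz _ y)) * g) -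
          Real.exp (-β * n) * ψ (g * cexp (m * t * I) • (toeplitz _ x * star (toeplitz _ y)))) =
        cexp ((m - n : ℤ) * t * I) * ((Real.exp (-β * m) - Real.exp (-β * n)) *
          ψ (g * (toeplitz _ x * star (toeplitz _ y)))) := by
      intro t
      have e' : cexp ((m - n : ℤ) * t * I) = cexp (-(n * t * I)) * cexp (m * t * I) := by
        rw [← Complex.exp_add]
        congr 1
        push_cast
        ring
      rw [smul_mul_assoc, mul_smul_comm, map_smul, map_smul,
        h.map_toeplitz_mul_star_mul hc hd hψ, ← hm, e', smul_eq_mul, smul_eq_mul]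
      ring
    simp only [e]
    rw [intervalIntegral.integral_mul_const]
    by_cases hmn : m = n
    · simp [hmn]
    · rw [integral_exp_int_mul (sub_ne_zero.2 hmn), zero_mul]

/-- For `s` in the dense span, where the integral vanishes, the integral for `f` equals that for `f
- s` and is at most a constant times `‖f - s‖`. Continuity of the orbit provides the integrability
needed to subtract. -/
theorem IsHeightTracial.integral_of_continuous (hc : 0 < c) (hd : 0 < d) (hψ : IsState ψ)
    (h : IsHeightTracial c d β ψ) (g : CStarGP (bsP c d)) (n : ℤ) {f : CStarGP (bsP c d)}
    (hf : Continuous fun t => bsDynamics c d t f) :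
    ∫ t : ℝ in (0)..(2 * Real.pi), cexp (-(n * t * I)) *
      (ψ (bsDynamics c d t f * g) - Real.exp (-β * n) * ψ (g * bsDynamics c d t f)) = 0 := by
  let L : CStarGP (bsP c d) → ℝ → ℂ := fun f t => cexp (-(n * t * I)) *
    (ψ (bsDynamics c d t f * g) - Real.exp (-β * n) * ψ (g * bsDynamics c d t f))
  let C : ℝ := ‖ψ‖ * ‖g‖ + Real.exp (-β * n) * (‖ψ‖ * ‖g‖)
  have hL : ∀ f t, ‖L f t‖ ≤ C * ‖f‖ := by
    intro f t
    have h1 : ‖ψ (bsDynamics c d t f * g)‖ ≤ ‖ψ‖ * (‖f‖ * ‖g‖) :=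
      (ψ.le_opNorm _).trans (by
        gcongr
        exact (norm_mul_le _ _).trans (by gcongr; exact norm_bsDynamics_le t f))
    have h2 : ‖ψ (g * bsDynamics c d t f)‖ ≤ ‖ψ‖ * (‖g‖ * ‖f‖) :=
      (ψ.le_opNorm _).trans (by
        gcongr
        exact (norm_mul_le _ _).trans (by gcongr; exact norm_bsDynamics_le t f))
    have h3 : ‖cexp (-(n * t * I))‖ = 1 := by
      have : (-(n * t * I) : ℂ) = (-(n * t) : ℝ) * I := by push_cast; ring
      rw [this, Complex.norm_exp_ofReal_mul_I]
    simp only [L]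
    rw [norm_mul, h3, one_mul]
    refine (norm_sub_le _ _).trans ?_
    rw [norm_mul, Complex.norm_real, Real.norm_of_nonneg (Real.exp_pos _).le]
    calc _ ≤ ‖ψ‖ * (‖f‖ * ‖g‖) + Real.exp (-β * n) * (‖ψ‖ * (‖g‖ * ‖f‖)) := by gcongr
      _ = C * ‖f‖ := by simp only [C]; ring
  have hLc : ∀ f, Continuous (fun t => bsDynamics c d t f) → Continuous (L f) := by
    intro f hf
    fun_prop
  have hbound : ∀ s ∈ toeplitzSpan (bsP c d),
      ‖∫ t : ℝ in (0)..(2 * Real.pi), L f t‖ ≤ C * ‖f - s‖ * |2 * Real.pi - 0| := by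
    intro s hs
    obtain ⟨hsc, hs0⟩ := h.integral_of_mem_span hc hd hψ g n hs
    have e : ∫ t : ℝ in (0)..(2 * Real.pi), L f t =
        ∫ t : ℝ in (0)..(2 * Real.pi), L (f - s) t := by
      have hsub : ∀ t, L (f - s) t = L f t - L s t := by
        intro t
        simp only [L, map_sub, sub_mul, mul_sub]
        ring
      simp only [hsub]
      rw [intervalIntegral.integral_sub ((hLc f hf).intervalIntegrable _ _)
        ((hLc s hsc).intervalIntegrable _ _), show ∫ t : ℝ in (0)..(2 * Real.pi), L s t = 0
        from hs0, sub_zero]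
    rw [e]
    exact intervalIntegral.norm_integral_le_of_norm_le_const fun t _ => hL _ t
  have hcl : f ∈ closure (toeplitzSpan (bsP c d) : Set (CStarGP (bsP c d))) :=
    dense_toeplitzSpan_bsP hc hd f
  have hle : ∀ s ∈ closure (toeplitzSpan (bsP c d) : Set (CStarGP (bsP c d))),
      ‖∫ t : ℝ in (0)..(2 * Real.pi), L f t‖ ≤ C * ‖f - s‖ * |2 * Real.pi - 0| :=
    closure_minimal (t := {s | _ ≤ C * ‖f - s‖ * |2 * Real.pi - 0|}) hbound
      (isClosed_le continuous_const (by fun_prop))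
  have h0 := hle f hcl
  rw [sub_self, norm_zero, mul_zero, zero_mul] at h0
  exact norm_le_zero_iff.1 h0

/-- Comparing Fourier coefficients along the real orbit avoids approximating `F(iβ)`, over which
norm approximation of `f` gives no control. -/
theorem IsHeightTracial.isKMSState (hc : 0 < c) (hd : 0 < d) (hψ : IsState ψ)
    (h : IsHeightTracial c d β ψ) : IsKMSState (bsDynamics c d) β ψ := by
  refine ⟨hψ, fun f g F hF _ => ?_, fun hβ t => ?_⟩
  · obtain ⟨hFd, hFt⟩ := hF
    have hF0 : F 0 = f := by
      have h0 := hFt 0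
      have h1 : bsDynamics c d 0 = bsGauge c d 1 := by rw [bsDynamics, Circle.exp_zero]
      rw [ofReal_zero] at h0
      rw [h0, h1]
      have h2 : heightChar c d 1 = 1 := by ext x; simp [heightChar]
      change gaugeHom (heightChar c d 1) f = f
      rw [h2, gaugeHom_one]
      rfl
    have hper : ∀ t : ℝ, F (t + 2 * Real.pi) = F t := by
      intro t
      have h1 := hFt (t + 2 * Real.pi)
      rw [bsDynamics_add_two_pi, ← hFt] at h1
      simpa using h1
    -- Periodicity is known at real times only; the identity theorem carries it to the line `t +
    -- iβ`.
    have hh : Differentiable ℂ fun z => ψ (g * F z) := by fun_prop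
    have hper' : ∀ z : ℂ, ψ (g * F (z + 2 * Real.pi)) = ψ (g * F z) := congrFun <|
      Differentiable.eq_of_eqOn_real (f := fun z => ψ (g * F (z + 2 * Real.pi))) (by fun_prop) hh
        fun t => by rw [hper]
    have hcont : Continuous fun t => bsDynamics c d t f := by
      simp only [← hFt]
      exact hFd.continuous.comp continuous_ofReal
    have hFc : Continuous F := hFd.continuous
    -- The contour shift turns the `n`-th coefficient of `ψ(g F(t + iβ))` into `e^(-βn)` times that
    -- of `ψ(g F(t))`, which `integral_of_continuous` equates with the coefficient of `ψ(F(t) g)`.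
    -- Evaluation at `t = 0` is the KMS identity.
    have key := Continuous.eq_zero_of_integral_exp_mul_eq_zero
      (D := fun t : ℝ => ψ (F t * g) - ψ (g * F (t + I * β))) (by fun_prop)
      (fun t => by
        have : ((t + 2 * Real.pi : ℝ) : ℂ) + I * β = t + I * β + 2 * Real.pi := by
          push_cast; ring
        dsimp only
        rw [this, hper', ofReal_add, ofReal_mul, ofReal_ofNat, hper])
      (fun n => by
        have h1 := h.integral_of_continuous hc hd hψ g n hcont
        have h2 := integral_exp_mul_add_I_mul hh (fun t => hper' t) β n
        simp only [← hFt, mul_sub] at h1 ⊢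
        rw [intervalIntegral.integral_sub] at h1 ⊢
        · rw [h2, ← intervalIntegral.integral_const_mul, ← h1]
          congr 1
          exact intervalIntegral.integral_congr fun t _ => by ring
        all_goals exact Continuous.intervalIntegrable (by fun_prop) _ _) 0
    rw [sub_eq_zero] at key
    simpa [hF0] using key
  · rw [← funext_iff (f := fun a => ψ (bsDynamics c d t a)) (g := ψ)]
    have hcont : Continuous (bsDynamics c d t) :=
      AddMonoidHomClass.continuous_of_bound (bsDynamics c d t) 1 fun f => by
        rw [one_mul]; exact norm_bsDynamics_le t f
    refine Continuous.ext_on (dense_toeplitzSpan_bsP hc hd) (by fun_prop) ψ.continuous ?_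
    intro f hf
    induction hf using Submodule.span_induction with
    | zero => simp
    | add f g _ _ hf hg => simp_all
    | smul s f _ hf => simp_all
    | mem f hf =>
      obtain ⟨⟨x, y⟩, rfl⟩ := hf
      simp only [bsDynamics_toeplitz_mul_star, map_smul]
      by_cases hxy : bsHeight c d x = bsHeight c d y
      · simp [hxy]
      · simp [h x y, hxy]

end Dynamics
end

theorem proposition5p1 (c d : ℕ) (hc : 0 < c) (hd : 0 < d) (β : ℝ) :
    (∀ ψ : CStarGP (bsP c d) →L[ℂ] ℂ, IsState ψ →
      (IsKMSState (bsDynamics c d) β ψ ↔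
        ∀ x y : bsP c d,
          (bsHeight c d x = bsHeight c d y → ∀ h : IsJoin (bsP c d) (x : BS c d) y x,
            ψ (toeplitz (bsP c d) x * star (toeplitz (bsP c d) y)) =
              (Real.exp (-β * bsHeight c d x) : ℂ) *
                ψ (toeplitz (bsP c d) ⟨(y : BS c d)⁻¹ * x, h.right_le⟩)) ∧
          (bsHeight c d x = bsHeight c d y → ∀ h : IsJoin (bsP c d) (x : BS c d) y y,
            ψ (toeplitz (bsP c d) x * star (toeplitz (bsP c d) y)) =
              (Real.exp (-β * bsHeight c d x) : ℂ) *
                ψ (star (toeplitz (bsP c d) ⟨(x : BS c d)⁻¹ * y, h.left_le⟩))) ∧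
          (¬ (bsHeight c d x = bsHeight c d y ∧
              (IsJoin (bsP c d) (x : BS c d) y x ∨ IsJoin (bsP c d) (x : BS c d) y y)) →
            ψ (toeplitz (bsP c d) x * star (toeplitz (bsP c d) y)) = 0))) ∧
    (∀ φ ψ : CStarGP (bsP c d) →L[ℂ] ℂ,
      IsKMSState (bsDynamics c d) β φ → IsKMSState (bsDynamics c d) β ψ →
      (∀ t : ℕ, φ (toeplitz (bsP c d) (bsB c d ^ t)) = ψ (toeplitz (bsP c d) (bsB c d ^ t))) →
      φ = ψ) := by
  refine ⟨fun ψ hψ => ?_, fun φ ψ hφ hψ h => ?_⟩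
  · rw [← isHeightTracial_iff hc hd]
    exact ⟨fun h => h.isHeightTracial, fun h => h.isKMSState hc hd hψ⟩
  · exact hφ.isHeightTracial.ext hc hd hφ.isState hψ.isState hψ.isHeightTracial h
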